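/- Let $M$ be the Gieseking manifold, i.e. the mapping torus of an orientation-reversing homeomorphism of the once-punctured torus inducing the automorphism $r\mapsto s$, $s\mapsto rs$ of the free fundamental group $\langle r,s\mid\ \rangle$ of the fibre, so that $$\pi_1(M)=\langle r,s,t\mid trt^{-1}=s,\ tst^{-1}=rs\rangle ,$$ where $r,s$ preserve and $t$ reverses the orientation of $M$. Let $G=\mathrm{Isom}(\mathbb H^3)=\mathrm{PSL}(2,\mathbb C)\rtimes\mathbb Z_2$, where $\mathbb Z_2$ acts by complex conjugation and $\mathrm{PSL}(2,\mathbb C)$ is the subgroup of orientation-preserving isometries. Let $\hom^{\mathrm{irr}}_+(\pi_1(M),G)$ be the space, with the topology of pointwise convergence, of all homomorphisms $\rho\colon\pi_1(M)\to G$ such that * $\rho$ preserves the orientation type: for every $\gamma\in\pi_1(M)$, $\rho(\gamma)$ preserves the orientation of $\mathbb H^3$ if and only if $\gamma$ is represented by a loop that preserves the orientation of $M$; * $\rho$ is irreducible: no complex line in $\mathbb C^2$ is invariant under all the elements $\rho(\gamma)$, $\gamma\in\pi_1(M)$, that lie in $\mathrm{PSL}(2,\mathbb C)$. Let $G$ act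 on this space by conjugation and give $\hom^{\mathrm{irr}}_+(\pi_1(M),G)/G$ the quotient topology. Every $\rho\in\hom^{\mathrm{irr}}_+(\pi_1(M),G)$ lifts to a homomorphism $\tilde\rho\colon\pi_1(M)\to\mathrm{SL}(2,\mathbb C)\rtimes\mathbb Z_2$, and $\operatorname{trace}(\rho(s)):=\operatorname{trace}(\tilde\rho(s))\in\mathbb C$ does not depend on the lift. The map $[\rho]\mapsto\operatorname{trace}(\rho(s))$ is a well-defined homeomorphism $$\hom^{\mathrm{irr}}_+(\pi_1(M),G)/G\ \longrightarrow\ \{x\in\mathbb C\mid |x-1|=1,\ x\neq 2\}/\!\sim ,$$ where $x\sim\bar x$ and the target has the quotient topology. In particular, $\hom^{\mathrm{irr}}_+(\pi_1(M),G)/G$ is homeomorphic to the half-open interval $[0,1)$. -/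

import Mathlib

open Matrix

noncomputable section

namespace Gieseking

/-! ### The fundamental group of the Gieseking manifold

The Gieseking manifold `M` is the mapping torus of an orientation-reversing homeomorphism of the
punctured torus whose action on the fundamental group `⟨r, s | ⟩` of the fibre is the algebraic
monodromy `r ↦ s`, `s ↦ r * s`. -/

/-- Generators: `r`, `s` generate the fundamental group of the fibre, `t` is the stable letter. -/
inductive Gen : Type
  | r
  | s
  | t

/-- The relators of `t r t⁻¹ = s` and `t s t⁻¹ = r s`. -/
def relators : Set (FreeGroup Gen) :=
  { FreeGroup.of Gen.t * FreeGroup.of Gen.r * (FreeGroup.of Gen.t)⁻¹ * (FreeGroup.of Gen.s)⁻¹,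
    FreeGroup.of Gen.t * FreeGroup.of Gen.s * (FreeGroup.of Gen.t)⁻¹ *
      (FreeGroup.of Gen.r * FreeGroup.of Gen.s)⁻¹ }

/-- `π₁(M) = ⟨r, s, t | t r t⁻¹ = s, t s t⁻¹ = r s⟩`. -/
abbrev Pi1 : Type := PresentedGroup relators

/-- The class of `s` in `π₁(M)`. -/
def s : Pi1 := PresentedGroup.of Gen.s

/-- The values of the orientation character on generators: the fibre is orientable and the
monodromy reverses its orientation, so `r`, `s` preserve the orientation of `M` and `t` does not. -/
def orientationGen : Gen → ℤˣ
  | Gen.r => 1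
  | Gen.s => 1
  | Gen.t => -1

/-- The orientation character of `M`: `orientationChar γ = 1` iff `γ` is represented by an
orientation-preserving loop. -/
def orientationChar : Pi1 →* ℤˣ :=
  PresentedGroup.toGroup (f := orientationGen) (by
    intro w hw
    rcases hw with rfl | rfl <;> simp [orientationGen])

/-! ### The isometry group of hyperbolic 3-space

`Isom(ℍ³) = PSL(2, ℂ) ⋊ ℤ/2`, where `ℤ/2 = Gal(ℂ/ℝ) = {1, complex conjugation}` acts on matrices
entrywise. The element `⟨[A], σ⟩` acts on `∂ℍ³ = ℂ ∪ {∞}` by `z ↦ A • σ z`, and is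
orientation-preserving iff `σ = 1`. -/

abbrev SL2 : Type := SpecialLinearGroup (Fin 2) ℂ

abbrev PSL2 : Type := ProjectiveSpecialLinearGroup (Fin 2) ℂ

/-- The group `{1, complex conjugation}`, cyclic of order two. -/
abbrev ConjGroup : Type := ℂ ≃ₐ[ℝ] ℂ

/-- Entrywise action of `{1, complex conjugation}` on `SL(2, ℂ)`. -/
def conjSL : ConjGroup →* MulAut SL2 where
  toFun σ :=
    { toFun := SpecialLinearGroup.map (σ : ℂ →+* ℂ)
      invFun := SpecialLinearGroup.map (σ.symm : ℂ →+* ℂ)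
      left_inv := fun A => by ext i j; simp
      right_inv := fun A => by ext i j; simp
      map_mul' := map_mul _ }
  map_one' := by ext A i j; simp
  map_mul' σ τ := by ext A i j; simp

/-- The induced action of `{1, complex conjugation}` on `PSL(2, ℂ) = SL(2, ℂ) / center`. -/
def conjPSL : ConjGroup →* MulAut PSL2 where
  toFun σ := QuotientGroup.congr _ _ (conjSL σ)
    (Subgroup.characteristic_iff_map_eq.mp inferInstance (conjSL σ))
  map_one' := by
    ext x
    induction x using QuotientGroup.induction_on with
    | H A => simp
  map_mul' σ τ := by
    ext x
    induction x using QuotientGroup.induction_on with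
    | H A => simp; rfl

/-- `G = Isom(ℍ³) = PSL(2, ℂ) ⋊ ℤ/2`. -/
abbrev IsomH3 : Type := PSL2 ⋊[conjPSL] ConjGroup

/-- The Lie group topology of `G`: the product of the quotient topology on `PSL(2, ℂ)` and the
discrete topology of `{1, complex conjugation}`. -/
instance : TopologicalSpace IsomH3 :=
  TopologicalSpace.induced (fun g => (g.left, g.right))
    (inferInstance : TopologicalSpace (PSL2 × ConjGroup))

/-- `g` is an orientation-preserving isometry. -/
def IsOrientationPreserving (g : IsomH3) : Prop := g.right = 1

/-! ### Representations -/

/-- `ρ` preserves the orientation type. -/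
def PreservesOrientationType (ρ : Pi1 →* IsomH3) : Prop :=
  ∀ γ, IsOrientationPreserving (ρ γ) ↔ orientationChar γ = 1

/-- `ρ` is irreducible: no line of `ℂ²` is invariant. The elements of `G` acting on `ℂ²` by linear
maps (up to sign) are those of `PSL(2, ℂ)`, so invariance is that under all `ρ γ ∈ PSL(2, ℂ)`. -/
def IsIrreducible (ρ : Pi1 →* IsomH3) : Prop :=
  ¬ ∃ L : Submodule ℂ (Fin 2 → ℂ), Module.finrank ℂ L = 1 ∧
    ∀ (γ : Pi1) (A : SL2), ρ γ = SemidirectProduct.inl (A : PSL2) →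
      ∀ v ∈ L, (A : Matrix (Fin 2) (Fin 2) ℂ) *ᵥ v ∈ L

/-- The irreducible representations that preserve the orientation type. -/
def HomIrrPlus : Type :=
  {ρ : Pi1 →* IsomH3 // IsIrreducible ρ ∧ PreservesOrientationType ρ}

/-- The topology of pointwise convergence. -/
instance : TopologicalSpace HomIrrPlus :=
  TopologicalSpace.induced (fun ρ => (ρ.1 : Pi1 → IsomH3)) Pi.topologicalSpace

/-- Conjugation by elements of `G`. -/
instance conjSetoid : Setoid HomIrrPlus where
  r ρ ρ' := ∃ g : IsomH3, ∀ γ, ρ'.1 γ = g * ρ.1 γ * g⁻¹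
  iseqv :=
    { refl := fun _ => ⟨1, fun _ => by simp⟩
      symm := fun ⟨g, h⟩ => ⟨g⁻¹, fun γ => by rw [h γ]; group⟩
      trans := fun ⟨g, h⟩ ⟨g', h'⟩ => ⟨g' * g, fun γ => by rw [h' γ, h γ]; group⟩ }

/-- The space of conjugacy classes, with the quotient topology. -/
abbrev ConjClassesIrrPlus : Type := Quotient conjSetoid

/-! ### The trace of `ρ(s)`

An element of `PSL(2, ℂ)` has a trace only up to sign. The sign is fixed by lifting `ρ` to
`SL(2, ℂ) ⋊ ℤ/2`. -/

/-- `ρ'` is a lift of `ρ` to `SL(2, ℂ) ⋊ ℤ/2`. -/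
def IsLift (ρ' : Pi1 →* SL2 ⋊[conjSL] ConjGroup) (ρ : Pi1 →* IsomH3) : Prop :=
  ∀ γ, ρ γ = ⟨((ρ' γ).left : PSL2), (ρ' γ).right⟩

/-- `x` is the trace of `ρ(s)`. -/
def IsTraceS (ρ : Pi1 →* IsomH3) (x : ℂ) : Prop :=
  ∃ ρ' : Pi1 →* SL2 ⋊[conjSL] ConjGroup, IsLift ρ' ρ ∧
    ((ρ' s).left : Matrix (Fin 2) (Fin 2) ℂ).trace = x

/-! ### The target space -/

/-- The circle `|x - 1| = 1` without the point `2`. -/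
abbrev PuncturedCircle : Type := {x : ℂ // ‖x - 1‖ = 1 ∧ x ≠ 2}

/-- Equality up to complex conjugation. -/
instance circleSetoid : Setoid PuncturedCircle where
  r x y := (y : ℂ) = x ∨ (y : ℂ) = starRingEnd ℂ x
  iseqv :=
    { refl := fun _ => Or.inl rfl
      symm := by
        rintro x y (h | h)
        · exact Or.inl h.symm
        · exact Or.inr (by rw [h]; simp)
      trans := by
        rintro x y z (h | h) (h' | h')
        · exact Or.inl (by rw [h', h])
        · exact Or.inr (by rw [h', h])
        · exact Or.inr (by rw [h', h])
        · exact Or.inl (by rw [h', h]; simp) }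

/-- The punctured circle modulo complex conjugation, with the quotient topology. -/
abbrev PuncturedCircleModConj : Type := Quotient circleSetoid

end Gieseking

end

/-!
Since the isometry group is a semidirect product, a representation that preserves the orientation
type is given by matrices `R`, `S`, `T` in `SL(2, ℂ)`, the last one composed with complex
conjugation, with `T R̄ = ± S T` and `T S̄ = ± R S T`. Changing the signs of `R` and `S` removes the
signs of the relations in exactly one way. Hence `ρ` lifts, and `x = tr S` is well defined
(`PreservesOrientationType.existsUnique_isTraceS`).

The relations give `tr R = tr (R S) = x̄`, and `tr (S R S) = x` becomes `|x|² = 2 Re x`, which is the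
circle `|x - 1| = 1` (`IsTriple.trace_mul_conj`). For `x = 2` the group is reducible
(`IsTripleOf.trace_ne_two`). For `x ≠ 2` already `R` and `S` have no common eigenvector
(`no_common_eigenvector`). With `q² = x - 2` and `p = q̄`, the matrix `S - 1 + q R⁻¹` has a kernel,
and a vector `v` in it gives a basis `v`, `-R⁻¹ v` in which
`R = !![p² + 2, -1; 1, 0]` and `S = !![1, q; q, q² + 1]` (`exists_conj_normal`). By Schur's lemma
`T` is then determined up to sign (`IsTriple.normal_unique`), so `x` determines the conjugacy class.
Conjugation by the reflection replaces `x` by `x̄`.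

Conversely an explicit solution `tMat p q` of the equations for `T` exists for each `x` on the
punctured circle. On the upper half circle, parametrised by `u = Re x / 2 ∈ [0, 1)`, there is a
branch of `q` for which the determinant of `tMat p q` stays in the slit plane, so that it can be
normalised continuously (`tMat_det_mem_slitPlane`). This gives a continuous family `normalRep`
meeting each conjugacy class once. In the other direction `u = |tr S|² / 4`, which is visibly a
continuous function on `PSL(2, ℂ)`; no continuity of the choice of a lift is needed. So `u`
identifies the space of conjugacy classes with `[0, 1)` (`classesHomeo`), and `u = Re x / 2`
identifies the punctured circle modulo conjugation with the same interval (`circleHomeo`).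
-/

noncomputable section

namespace Gieseking

/-! ### Homomorphisms out of the fundamental group -/

/-- The homomorphism `π₁(M) → H` with prescribed values `a`, `b`, `c` on `r`, `s`, `t`. -/
def homOfRelations {H : Type*} [Group H] (a b c : H) (h₁ : c * a * c⁻¹ = b)
    (h₂ : c * b * c⁻¹ = a * b) : Pi1 →* H :=
  PresentedGroup.toGroup (f := fun x => Gen.casesOn x a b c) (by
    rintro w (rfl | rfl) <;> simp [h₁, h₂])

section homOfRelations

variable {H : Type*} [Group H] {a b c : H} (h₁ : c * a * c⁻¹ = b) (h₂ : c * b * c⁻¹ = a * b)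

@[simp] lemma homOfRelations_r : homOfRelations a b c h₁ h₂ (PresentedGroup.of Gen.r) = a :=
  PresentedGroup.toGroup.of _

@[simp] lemma homOfRelations_s : homOfRelations a b c h₁ h₂ s = b :=
  PresentedGroup.toGroup.of _

@[simp] lemma homOfRelations_t : homOfRelations a b c h₁ h₂ (PresentedGroup.of Gen.t) = c :=
  PresentedGroup.toGroup.of _

end homOfRelations

lemma t_mul_r : (PresentedGroup.of Gen.t * PresentedGroup.of Gen.r : Pi1) =
    s * PresentedGroup.of Gen.t := by
  have h : (PresentedGroup.mk relators) (FreeGroup.of Gen.t * FreeGroup.of Gen.r *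
      (FreeGroup.of Gen.t)⁻¹ * (FreeGroup.of Gen.s)⁻¹) = 1 :=
    PresentedGroup.one_of_mem (Or.inl rfl)
  rw [map_mul, map_inv, mul_inv_eq_one, map_mul, map_inv, mul_inv_eq_iff_eq_mul, map_mul] at h
  exact h

lemma t_mul_s : (PresentedGroup.of Gen.t * s : Pi1) =
    PresentedGroup.of Gen.r * s * PresentedGroup.of Gen.t := by
  have h : (PresentedGroup.mk relators) (FreeGroup.of Gen.t * FreeGroup.of Gen.s *
      (FreeGroup.of Gen.t)⁻¹ * (FreeGroup.of Gen.r * FreeGroup.of Gen.s)⁻¹) = 1 :=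
    PresentedGroup.one_of_mem (Or.inr rfl)
  rw [map_mul, map_inv, mul_inv_eq_one, map_mul, map_inv, mul_inv_eq_iff_eq_mul, map_mul,
    map_mul] at h
  exact h

lemma pi1_induction {P : Pi1 → Prop} (one : P 1) (r : P (PresentedGroup.of Gen.r)) (hs : P s)
    (t : P (PresentedGroup.of Gen.t)) (inv : ∀ γ, P γ → P γ⁻¹)
    (mul : ∀ γ δ, P γ → P δ → P (γ * δ)) (γ : Pi1) : P γ := by
  induction γ using PresentedGroup.induction_on with
  | _ z =>
    induction z using FreeGroup.induction_on with
    | C1 => simpa using one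
    | of x => cases x <;> assumption
    | inv_of x h => simpa using inv _ h
    | mul x y hx hy => simpa using mul _ _ hx hy

lemma hom_eq_of_generators {H : Type*} [Group H] {φ ψ : Pi1 →* H}
    (r : φ (PresentedGroup.of Gen.r) = ψ (PresentedGroup.of Gen.r)) (hs : φ s = ψ s)
    (t : φ (PresentedGroup.of Gen.t) = ψ (PresentedGroup.of Gen.t)) : φ = ψ :=
  PresentedGroup.ext fun x => by cases x <;> assumption

@[simp] lemma orientationChar_r : orientationChar (PresentedGroup.of Gen.r) = 1 :=
  PresentedGroup.toGroup.of _

@[simp] lemma orientationChar_s : orientationChar s = 1 :=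
  PresentedGroup.toGroup.of _

@[simp] lemma orientationChar_t : orientationChar (PresentedGroup.of Gen.t) = -1 :=
  PresentedGroup.toGroup.of _

/-! ### Complex conjugation on matrices -/

/-- Entrywise complex conjugation on `SL(2, ℂ)`. -/
def bar : SL2 ≃* SL2 := conjSL Complex.conjAe

@[simp] lemma bar_apply (A : SL2) (i j : Fin 2) : bar A i j = starRingEnd ℂ (A i j) := rfl

lemma conjGroup_cases (σ : ConjGroup) : σ = 1 ∨ σ = Complex.conjAe := by
  rcases Complex.real_algHom_eq_id_or_conj (σ : ℂ →ₐ[ℝ] ℂ) with h | h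
  · exact Or.inl (AlgEquiv.ext fun z => DFunLike.congr_fun h z)
  · exact Or.inr (AlgEquiv.ext fun z => DFunLike.congr_fun h z)

lemma conjAe_ne_one : (Complex.conjAe : ConjGroup) ≠ 1 := by
  intro h
  have := congrArg Complex.im (DFunLike.congr_fun h Complex.I)
  simp at this
  norm_num at this

lemma conjAe_mul_conjAe : (Complex.conjAe * Complex.conjAe : ConjGroup) = 1 :=
  AlgEquiv.ext fun z => by simp

lemma conjAe_inv : (Complex.conjAe : ConjGroup)⁻¹ = Complex.conjAe :=
  inv_eq_of_mul_eq_one_left conjAe_mul_conjAe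

@[simp] lemma conjSL_conjAe (A : SL2) : conjSL Complex.conjAe A = bar A := rfl

lemma bar_neg (A : SL2) : bar (-A) = -bar A := by
  ext i j; simp

@[simp] lemma bar_bar (A : SL2) : bar (bar A) = A := by
  ext i j; simp

lemma trace_bar (A : SL2) : (bar A).1.trace = starRingEnd ℂ A.1.trace := by
  simp [Matrix.trace_fin_two]

/-! ### Passing between `SL(2, ℂ)` and `PSL(2, ℂ)` -/

lemma psl_eq_iff {A B : SL2} : (A : PSL2) = B ↔ A = B ∨ A = -B := by
  rw [QuotientGroup.eq, Matrix.SpecialLinearGroup.mem_center_iff]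
  constructor
  · rintro ⟨c, hc, h⟩
    have hB : (B : Matrix (Fin 2) (Fin 2) ℂ) = c • (A : Matrix (Fin 2) (Fin 2) ℂ) := by
      have : (B : Matrix (Fin 2) (Fin 2) ℂ) = (A * (A⁻¹ * B) : SL2) := by simp
      rw [this, Matrix.SpecialLinearGroup.coe_mul, ← h]
      simp [Matrix.smul_eq_mul_diagonal]
    rcases mul_self_eq_one_iff.mp ((sq c).symm.trans hc) with rfl | rfl
    · left; ext i j; simp [hB]
    · right; ext i j; simp [hB]
  · rintro (rfl | rfl)
    · exact ⟨1, by simp, by simp⟩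
    · refine ⟨-1, by simp, ?_⟩
      ext i j
      rw [show (-B)⁻¹ * B = -1 by rw [inv_neg]; simp]
      fin_cases i <;> fin_cases j <;> simp

@[simp] lemma psl_neg (A : SL2) : ((-A : SL2) : PSL2) = A := psl_eq_iff.mpr (Or.inr rfl)

@[simp] lemma conjPSL_coe (σ : ConjGroup) (A : SL2) :
    conjPSL σ (A : PSL2) = (conjSL σ A : SL2) := rfl

/-- The projection `SL(2, ℂ) ⋊ ℤ/2 → PSL(2, ℂ) ⋊ ℤ/2`. -/
def proj : SL2 ⋊[conjSL] ConjGroup →* IsomH3 :=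
  SemidirectProduct.map (QuotientGroup.mk' _) (MonoidHom.id _) fun _ => rfl

lemma proj_apply (g : SL2 ⋊[conjSL] ConjGroup) : proj g = ⟨(g.left : PSL2), g.right⟩ := rfl

/-! ### Matrix data of a representation -/

/-- The relations of `π₁(M)` for `r ↦ R`, `s ↦ S` and `t ↦ T ∘ (complex conjugation)` in
`SL(2, ℂ) ⋊ ℤ/2`. -/
structure IsTriple (R S T : SL2) : Prop where
  rel_r : T * bar R = S * T
  rel_s : T * bar S = R * S * T

/-- The matrices `R`, `S`, `T` satisfy the relations of `π₁(M)` and represent the values of `ρ` at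
`r`, `s`, `t`. -/
structure IsTripleOf (ρ : Pi1 →* IsomH3) (R S T : SL2) : Prop extends IsTriple R S T where
  map_r : ρ (PresentedGroup.of Gen.r) = ⟨(R : PSL2), 1⟩
  map_s : ρ s = ⟨(S : PSL2), 1⟩
  map_t : ρ (PresentedGroup.of Gen.t) = ⟨(T : PSL2), Complex.conjAe⟩

/-- The representation in `SL(2, ℂ) ⋊ ℤ/2` with given matrix data. -/
def IsTriple.lift {R S T : SL2} (h : IsTriple R S T) : Pi1 →* SL2 ⋊[conjSL] ConjGroup :=
  homOfRelations ⟨R, 1⟩ ⟨S, 1⟩ ⟨T, Complex.conjAe⟩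
    (by rw [mul_inv_eq_iff_eq_mul]; ext1 <;> simp [h.rel_r])
    (by rw [mul_inv_eq_iff_eq_mul]; ext1 <;> simp [h.rel_s])

/-- The representation in `Isom(ℍ³)` with given matrix data. -/
def IsTriple.rep {R S T : SL2} (h : IsTriple R S T) : Pi1 →* IsomH3 := proj.comp h.lift

lemma IsTriple.isTripleOf {R S T : SL2} (h : IsTriple R S T) : IsTripleOf h.rep R S T where
  toIsTriple := h
  map_r := congrArg proj (homOfRelations_r _ _)
  map_s := congrArg proj (homOfRelations_s _ _)
  map_t := congrArg proj (homOfRelations_t _ _)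

lemma IsTripleOf.eq_rep {ρ : Pi1 →* IsomH3} {R S T : SL2} (h : IsTripleOf ρ R S T) :
    ρ = h.toIsTriple.rep :=
  have h' := h.toIsTriple.isTripleOf
  hom_eq_of_generators (by rw [h.map_r, h'.map_r]) (by rw [h.map_s, h'.map_s])
    (by rw [h.map_t, h'.map_t])

lemma IsTripleOf.isLift {ρ : Pi1 →* IsomH3} {R S T : SL2} (h : IsTripleOf ρ R S T) :
    IsLift h.toIsTriple.lift ρ := fun γ => by
  rw [← proj_apply]; exact DFunLike.congr_fun h.eq_rep γ

lemma IsTripleOf.isTraceS {ρ : Pi1 →* IsomH3} {R S T : SL2} (h : IsTripleOf ρ R S T) :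
    IsTraceS ρ S.1.trace :=
  ⟨_, h.isLift, by simp [IsTriple.lift]⟩

lemma exists_coe_mk_eq {g : IsomH3} {σ : ConjGroup} (h : g.right = σ) :
    ∃ A : SL2, g = ⟨(A : PSL2), σ⟩ := by
  obtain ⟨A, hA⟩ := QuotientGroup.mk_surjective g.left
  exact ⟨A, by ext1 <;> simp [hA, h]⟩

lemma PreservesOrientationType.right_r {ρ : Pi1 →* IsomH3} (h : PreservesOrientationType ρ) :
    (ρ (PresentedGroup.of Gen.r)).right = 1 := (h _).mpr orientationChar_r

lemma PreservesOrientationType.right_s {ρ : Pi1 →* IsomH3} (h : PreservesOrientationType ρ) :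
    (ρ s).right = 1 := (h _).mpr orientationChar_s

lemma PreservesOrientationType.right_t {ρ : Pi1 →* IsomH3} (h : PreservesOrientationType ρ) :
    (ρ (PresentedGroup.of Gen.t)).right = Complex.conjAe := by
  refine (conjGroup_cases _).resolve_left fun h1 => ?_
  have := (h _).mp h1
  rw [orientationChar_t] at this
  exact absurd this (by decide)

/-- Representations that preserve the orientation type lift: for arbitrary matrices over `ρ r`,
`ρ s`, `ρ t` the relations hold up to signs `a`, `b`, and replacing `R` by `b R` and `S` by `a b S`
removes them. -/
lemma PreservesOrientationType.exists_isTripleOf {ρ : Pi1 →* IsomH3}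
    (h : PreservesOrientationType ρ) : ∃ R S T, IsTripleOf ρ R S T := by
  obtain ⟨R, hR⟩ := exists_coe_mk_eq h.right_r
  obtain ⟨S, hS⟩ := exists_coe_mk_eq h.right_s
  obtain ⟨T, hT⟩ := exists_coe_mk_eq h.right_t
  have h1 := congrArg (fun γ => (ρ γ).left) t_mul_r
  have h2 := congrArg (fun γ => (ρ γ).left) t_mul_s
  simp only [map_mul, hR, hS, hT, SemidirectProduct.mul_left, SemidirectProduct.mul_right, map_one,
    one_mul, MulAut.one_apply, conjPSL_coe, conjSL_conjAe, ← QuotientGroup.mk_mul, psl_eq_iff]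
    at h1 h2
  rcases h1 with h1 | h1 <;> rcases h2 with h2 | h2
  · exact ⟨R, S, T, ⟨h1, h2⟩, hR, hS, hT⟩
  · exact ⟨-R, -S, T, ⟨by simp [bar_neg, h1], by simp [bar_neg, h2]⟩, by simpa using hR,
      by simpa using hS, hT⟩
  · exact ⟨R, -S, T, ⟨by simp [h1], by simp [bar_neg, h2]⟩, hR, by simpa using hS, hT⟩
  · exact ⟨-R, S, T, ⟨by simp [bar_neg, h1], by simp [h2]⟩, by simpa using hR, hS, hT⟩

lemma IsTripleOf.of_isLift (ρ' : Pi1 →* SL2 ⋊[conjSL] ConjGroup) {ρ : Pi1 →* IsomH3}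
    (h : PreservesOrientationType ρ) (hl : IsLift ρ' ρ) :
    IsTripleOf ρ (ρ' (PresentedGroup.of Gen.r)).left (ρ' s).left
      (ρ' (PresentedGroup.of Gen.t)).left := by
  have hr : (ρ' (PresentedGroup.of Gen.r)).right = 1 := by rw [← h.right_r, hl]
  have hs : (ρ' s).right = 1 := by rw [← h.right_s, hl]
  have ht : (ρ' (PresentedGroup.of Gen.t)).right = Complex.conjAe := by rw [← h.right_t, hl]
  have h1 := congrArg (fun γ => (ρ' γ).left) t_mul_r
  have h2 := congrArg (fun γ => (ρ' γ).left) t_mul_s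
  simp only [map_mul, hr, hs, ht, SemidirectProduct.mul_left, SemidirectProduct.mul_right, map_one,
    one_mul, MulAut.one_apply, conjSL_conjAe] at h1 h2
  exact ⟨⟨h1, h2⟩, by rw [hl, hr], by rw [hl, hs], by rw [hl, ht]⟩

lemma sl_ne_neg_self (A : SL2) : A ≠ -A := by
  intro h
  have h0 : ∀ i j, A i j = 0 := fun i j => by
    have := congrArg (fun B : SL2 => B i j) h
    simpa [self_eq_neg] using this
  have := A.det_coe
  rw [Matrix.det_fin_two] at this
  simp [h0] at this

/-- The signs of the matrices over `ρ r` and `ρ s` are determined by the relations. -/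
lemma IsTripleOf.eq_of_eq {ρ : Pi1 →* IsomH3} {R S T R' S' T' : SL2} (h : IsTripleOf ρ R S T)
    (h' : IsTripleOf ρ R' S' T') : R = R' ∧ S = S' := by
  have hr := congrArg SemidirectProduct.left (h.map_r.symm.trans h'.map_r)
  have hs := congrArg SemidirectProduct.left (h.map_s.symm.trans h'.map_s)
  have ht := congrArg SemidirectProduct.left (h.map_t.symm.trans h'.map_t)
  simp only [psl_eq_iff] at hr hs ht
  have h1 := h.rel_r
  have h2 := h.rel_s
  have h1' := h'.rel_r
  have h2' := h'.rel_s
  rcases hr with rfl | rfl <;> rcases hs with rfl | rfl <;> rcases ht with rfl | rfl <;>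
    simp [bar_neg, h1', h2', sl_ne_neg_self, (sl_ne_neg_self _).symm] at h1 h2 ⊢

/-- The trace of `ρ(s)` exists and is unique. -/
lemma PreservesOrientationType.existsUnique_isTraceS {ρ : Pi1 →* IsomH3}
    (h : PreservesOrientationType ρ) : ∃! x, IsTraceS ρ x := by
  obtain ⟨R, S, T, hρ⟩ := h.exists_isTripleOf
  refine ⟨_, hρ.isTraceS, ?_⟩
  rintro x ⟨ρ', hl, rfl⟩
  rw [((IsTripleOf.of_isLift ρ' h hl).eq_of_eq hρ).2]

/-! ### Trace relations -/

lemma trace_eq_conj_of_mul_bar_eq {A B T : SL2} (h : T * bar A = B * T) :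
    B.1.trace = starRingEnd ℂ A.1.trace := by
  have hB : B = T * bar A * T⁻¹ := eq_mul_inv_of_mul_eq h.symm
  rw [← trace_bar, hB, Matrix.SpecialLinearGroup.coe_mul, Matrix.trace_mul_comm,
    ← Matrix.SpecialLinearGroup.coe_mul]
  simp

lemma IsTriple.conj_trace {R S T : SL2} (h : IsTriple R S T) :
    starRingEnd ℂ S.1.trace = R.1.trace := by
  rw [trace_eq_conj_of_mul_bar_eq h.rel_r, Complex.conj_conj]

lemma IsTriple.trace_mul {R S T : SL2} (h : IsTriple R S T) :
    (R * S).1.trace = R.1.trace := by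
  rw [trace_eq_conj_of_mul_bar_eq h.rel_s, h.conj_trace]

/-- The circle equation, in the form `|x|² = 2 Re x`: it is the trace identity
`tr (S R S) = tr S tr (R S) - tr R`, because `S R S` is conjugate to the complex conjugate of
`R S`. -/
lemma IsTriple.trace_mul_conj {R S T : SL2} (h : IsTriple R S T) :
    S.1.trace * starRingEnd ℂ S.1.trace = S.1.trace + starRingEnd ℂ S.1.trace := by
  have h1 : T * bar (R * S) = S * (R * S) * T := by
    rw [map_mul, ← mul_assoc, h.rel_r, mul_assoc, h.rel_s]; group
  have h2 := trace_eq_conj_of_mul_bar_eq h1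
  have h3 := h.trace_mul
  have hS := S.det_coe
  rw [h3, ← h.conj_trace, Complex.conj_conj] at h2
  rw [h.conj_trace]
  simp only [Matrix.SpecialLinearGroup.coe_mul, Matrix.trace_fin_two, Matrix.mul_apply,
    Fin.sum_univ_two, Matrix.det_fin_two] at *
  linear_combination h2 - (S.1 0 0 + S.1 1 1) * h3 + (R.1 0 0 + R.1 1 1) * hS

/-! ### Lines in `ℂ²` -/

lemma exists_eq_smul_of_det_eq_zero {v z : Fin 2 → ℂ} (hv : v ≠ 0) (h : v 0 * z 1 = v 1 * z 0) :
    ∃ c : ℂ, z = c • v := by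
  by_cases h0 : v 0 = 0
  · have h1 : v 1 ≠ 0 := fun h1 => hv (by ext i; fin_cases i <;> simp [h0, h1])
    refine ⟨z 1 / v 1, ?_⟩
    have h2 : z 0 = 0 := by simpa [h0, h1] using h
    ext i; fin_cases i
    · simp [h2, h0]
    · simp [h1]
  · refine ⟨z 0 / v 0, ?_⟩
    ext i; fin_cases i
    · simp [h0]
    · simp only [Fin.mk_one, Pi.smul_apply, smul_eq_mul]
      field_simp
      linear_combination h

lemma exists_eq_smul_of_mulVec_eq_zero {N : Matrix (Fin 2) (Fin 2) ℂ} (hN : N ≠ 0)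
    {v z : Fin 2 → ℂ} (hv : v ≠ 0) (h1 : N *ᵥ v = 0) (h2 : N *ᵥ z = 0) : ∃ c : ℂ, z = c • v := by
  apply exists_eq_smul_of_det_eq_zero hv
  by_contra hd
  rw [← sub_eq_zero] at hd
  apply hN
  ext i j
  have e1 := congrFun h1 i
  have e2 := congrFun h2 i
  simp only [Matrix.mulVec, dotProduct, Fin.sum_univ_two, Pi.zero_apply] at e1 e2
  apply (mul_eq_zero.mp _).resolve_right hd
  fin_cases j
  · simp only [Fin.zero_eta]; linear_combination z 1 * e1 - v 1 * e2
  · simp only [Fin.mk_one]; linear_combination v 0 * e2 - z 0 * e1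

/-- Two nilpotent `2 × 2` matrices with `tr (M N) = 0` have a common kernel. -/
lemma exists_common_kernel {M N : Matrix (Fin 2) (Fin 2) ℂ} (hN : N ≠ 0) (tN : N.trace = 0)
    (dN : N.det = 0) (tM : M.trace = 0) (dM : M.det = 0) (tMN : (M * N).trace = 0) :
    ∃ v : Fin 2 → ℂ, v ≠ 0 ∧ M *ᵥ v = 0 ∧ N *ᵥ v = 0 := by
  have sq : ∀ A : Matrix (Fin 2) (Fin 2) ℂ, A.trace = 0 → A.det = 0 → A * A = 0 := by
    intro A h1 h2
    rw [Matrix.trace_fin_two] at h1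
    rw [Matrix.det_fin_two] at h2
    ext i j
    fin_cases i <;> fin_cases j <;>
      simp only [Matrix.mul_apply, Fin.sum_univ_two, Fin.zero_eta, Fin.mk_one, Matrix.zero_apply]
    · linear_combination A 0 0 * h1 - h2
    · linear_combination A 0 1 * h1
    · linear_combination A 1 0 * h1
    · linear_combination A 1 1 * h1 - h2
  have hNMN : N * (M * N) = 0 := by
    simp only [Matrix.trace_fin_two, Matrix.det_fin_two, Matrix.mul_apply,
      Fin.sum_univ_two] at tMN dN
    ext i j
    fin_cases i <;> fin_cases j <;>
      simp only [Matrix.mul_apply, Fin.sum_univ_two, Fin.zero_eta, Fin.mk_one, Matrix.zero_apply]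
    · linear_combination N 0 0 * tMN - M 1 1 * dN
    · linear_combination N 0 1 * tMN + M 0 1 * dN
    · linear_combination N 1 0 * tMN + M 1 0 * dN
    · linear_combination N 1 1 * tMN - M 0 0 * dN
  obtain ⟨w, hw⟩ : ∃ w, N *ᵥ w ≠ 0 := by
    by_contra! h
    exact hN (Matrix.ext_of_mulVec_single fun i => by
      rw [h, Matrix.zero_mulVec])
  have hNN : N *ᵥ (N *ᵥ w) = 0 := by rw [Matrix.mulVec_mulVec, sq N tN dN, Matrix.zero_mulVec]
  obtain ⟨c, hc⟩ := exists_eq_smul_of_mulVec_eq_zero (z := M *ᵥ (N *ᵥ w)) hN hw hNN (by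
    rw [Matrix.mulVec_mulVec, Matrix.mulVec_mulVec, mul_assoc, hNMN, Matrix.zero_mulVec])
  have hcc : M *ᵥ (M *ᵥ (N *ᵥ w)) = 0 := by
    rw [Matrix.mulVec_mulVec, sq M tM dM, Matrix.zero_mulVec]
  rw [hc, Matrix.mulVec_smul, hc, smul_smul, smul_eq_zero] at hcc
  have c0 : c = 0 := by simpa using hcc.resolve_right hw
  exact ⟨N *ᵥ w, hw, by rw [hc, c0, zero_smul], hNN⟩

/-! ### The semilinear action on `ℂ²` and reducibility -/

/-- The semilinear action of `SL(2, ℂ) ⋊ ℤ/2` on `ℂ²`. -/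
def act (g : SL2 ⋊[conjSL] ConjGroup) (v : Fin 2 → ℂ) : Fin 2 → ℂ :=
  g.left.1 *ᵥ fun i => g.right (v i)

lemma act_one (v : Fin 2 → ℂ) : act 1 v = v := by simp [act]

lemma act_mul (g h : SL2 ⋊[conjSL] ConjGroup) (v : Fin 2 → ℂ) :
    act (g * h) v = act g (act h v) := by
  simp only [act, SemidirectProduct.mul_left, SemidirectProduct.mul_right,
    Matrix.SpecialLinearGroup.coe_mul, ← Matrix.mulVec_mulVec]
  congr 1
  ext i
  simp [conjSL, Matrix.mulVec, dotProduct]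

lemma act_smul (g : SL2 ⋊[conjSL] ConjGroup) (c : ℂ) (v : Fin 2 → ℂ) :
    act g (c • v) = g.right c • act g v := by
  simp only [act, ← Matrix.mulVec_smul]
  congr 1
  ext i
  simp

/-- `g` maps the line through `u` into the line through `v`. -/
def MapsLine (g : SL2 ⋊[conjSL] ConjGroup) (u v : Fin 2 → ℂ) : Prop := ∃ c : ℂ, act g u = c • v

lemma MapsLine.one (u : Fin 2 → ℂ) : MapsLine 1 u u := ⟨1, by simp [act_one]⟩

lemma MapsLine.mul {g h : SL2 ⋊[conjSL] ConjGroup} {u v w : Fin 2 → ℂ} (hg : MapsLine g v w)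
    (hh : MapsLine h u v) : MapsLine (g * h) u w := by
  obtain ⟨c, hc⟩ := hg
  obtain ⟨d, hd⟩ := hh
  exact ⟨g.right d * c, by rw [act_mul, hd, act_smul, hc, smul_smul]⟩

lemma MapsLine.inv {g : SL2 ⋊[conjSL] ConjGroup} {u v : Fin 2 → ℂ} (hu : u ≠ 0)
    (hg : MapsLine g u v) : MapsLine g⁻¹ v u := by
  obtain ⟨c, hc⟩ := hg
  have h : u = g⁻¹.right c • act g⁻¹ v := by
    rw [← act_smul, ← hc, ← act_mul, inv_mul_cancel, act_one]
  have h0 : g⁻¹.right c ≠ 0 := fun h0 => hu (by rw [h, h0, zero_smul])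
  refine ⟨(g⁻¹.right c)⁻¹, ?_⟩
  conv_rhs => rw [h]
  rw [smul_smul, inv_mul_cancel₀ h0, one_smul]

lemma mapsLine_mk_one {A : SL2} {v : Fin 2 → ℂ} {c : ℂ} (h : A.1 *ᵥ v = c • v) :
    MapsLine ⟨A, 1⟩ v v := ⟨c, h⟩

/-- If two lines are invariant under `R` and `S`, and `T ∘ (complex conjugation)` exchanges them,
then the orientation-preserving elements preserve both. -/
lemma IsTripleOf.not_isIrreducible {ρ : Pi1 →* IsomH3} {R S T : SL2} (h : IsTripleOf ρ R S T)
    {v v' : Fin 2 → ℂ} (hv : v ≠ 0) (hv' : v' ≠ 0) (hR : MapsLine ⟨R, 1⟩ v v)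
    (hR' : MapsLine ⟨R, 1⟩ v' v') (hS : MapsLine ⟨S, 1⟩ v v) (hS' : MapsLine ⟨S, 1⟩ v' v')
    (hT : MapsLine ⟨T, Complex.conjAe⟩ v v') (hT' : MapsLine ⟨T, Complex.conjAe⟩ v' v) :
    ¬ IsIrreducible ρ := by
  set L := h.toIsTriple.lift with hL
  have key : ∀ γ, ((L γ).right = 1 ∧ MapsLine (L γ) v v ∧ MapsLine (L γ) v' v') ∨
      ((L γ).right = Complex.conjAe ∧ MapsLine (L γ) v v' ∧ MapsLine (L γ) v' v) := by
    refine pi1_induction (Or.inl ?_) (Or.inl ?_) (Or.inl ?_) (Or.inr ?_) ?_ ?_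
    · rw [map_one]; exact ⟨rfl, MapsLine.one v, MapsLine.one v'⟩
    · rw [hL, IsTriple.lift, homOfRelations_r]; exact ⟨rfl, hR, hR'⟩
    · rw [hL, IsTriple.lift, homOfRelations_s]; exact ⟨rfl, hS, hS'⟩
    · rw [hL, IsTriple.lift, homOfRelations_t]; exact ⟨rfl, hT, hT'⟩
    · rintro γ (⟨h1, h2, h3⟩ | ⟨h1, h2, h3⟩) <;> rw [map_inv, SemidirectProduct.inv_right, h1]
      · exact Or.inl ⟨inv_one, h2.inv hv, h3.inv hv'⟩
      · exact Or.inr ⟨conjAe_inv, h3.inv hv', h2.inv hv⟩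
    · rintro γ δ (⟨h1, h2, h3⟩ | ⟨h1, h2, h3⟩) (⟨k1, k2, k3⟩ | ⟨k1, k2, k3⟩) <;>
        rw [map_mul, SemidirectProduct.mul_right, h1, k1]
      · exact Or.inl ⟨one_mul _, h2.mul k2, h3.mul k3⟩
      · exact Or.inr ⟨one_mul _, h3.mul k2, h2.mul k3⟩
      · exact Or.inr ⟨mul_one _, h2.mul k2, h3.mul k3⟩
      · exact Or.inl ⟨conjAe_mul_conjAe, h3.mul k2, h2.mul k3⟩
  rw [IsIrreducible, not_not]
  refine ⟨Submodule.span ℂ {v}, finrank_span_singleton hv, fun γ A hA w hw => ?_⟩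
  have hl := h.isLift γ
  rw [hA, ← hL] at hl
  have hr : (L γ).right = 1 := (congrArg SemidirectProduct.right hl).symm
  have hA' : (A : PSL2) = (L γ).left := congrArg SemidirectProduct.left hl
  obtain ⟨-, ⟨c, hc⟩, -⟩ := (key γ).resolve_right fun h' => conjAe_ne_one (h'.1.symm.trans hr)
  obtain ⟨d, rfl⟩ := Submodule.mem_span_singleton.mp hw
  have hc' : (L γ).left.1 *ᵥ v = c • v := by
    rw [← hc, act, hr]; rfl
  rw [Submodule.mem_span_singleton]
  rcases psl_eq_iff.mp hA' with e | e
  · exact ⟨d * c, by rw [e, Matrix.mulVec_smul, hc', smul_smul]⟩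
  · refine ⟨d * -c, ?_⟩
    rw [e, Matrix.SpecialLinearGroup.coe_neg, Matrix.neg_mulVec, Matrix.mulVec_smul, hc',
      smul_smul, mul_neg, neg_smul]

/-- The point `2` is excluded: there `R`, `S` are trivial, and an eigenvector of
`(T ∘ (complex conjugation))²` spans an invariant line, or they have a unique common fixed line,
which is then invariant under `T ∘ (complex conjugation)` as well. -/
lemma IsTripleOf.trace_ne_two {ρ : Pi1 →* IsomH3} {R S T : SL2} (h : IsTripleOf ρ R S T)
    (hirr : IsIrreducible ρ) : S.1.trace ≠ 2 := by
  intro hx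
  have tR : R.1.trace = 2 := by rw [← h.conj_trace, hx]; exact map_ofNat _ 2
  have tRS : (R.1 * S.1).trace = 2 := h.trace_mul.trans tR
  have det_sub : ∀ A : SL2, A.1.trace = 2 → (A.1 - 1).det = 0 := by
    intro A hA
    have hd := A.det_coe
    simp only [Matrix.trace_fin_two, Matrix.det_fin_two] at hA hd ⊢
    simp only [Matrix.sub_apply, Matrix.one_apply_eq, ne_eq, zero_ne_one, one_ne_zero,
      not_false_eq_true, Matrix.one_apply_ne]
    linear_combination hd - hA
  by_cases hS1 : S = 1
  · have hR1 : R = 1 := by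
      have := h.rel_r
      rw [hS1, one_mul, mul_eq_left] at this
      exact (MulEquiv.map_eq_one_iff bar).mp this
    obtain ⟨c, hc⟩ := Module.End.exists_eigenvalue (Matrix.toLin' (T * bar T).1)
    obtain ⟨v, hv⟩ := hc.exists_hasEigenvector
    have hv0 := hv.2
    have hv1 := hv.apply_eq_smul
    rw [Matrix.toLin'_apply] at hv1
    have h1 : MapsLine ⟨T * bar T, 1⟩ v v := ⟨c, hv1⟩
    have hm : (⟨T, Complex.conjAe⟩ * ⟨T, Complex.conjAe⟩ : SL2 ⋊[conjSL] ConjGroup) =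
        ⟨T * bar T, 1⟩ := by
      ext1
      · rfl
      · exact conjAe_mul_conjAe
    have hT : act ⟨T, Complex.conjAe⟩ v ≠ 0 := by
      intro h0
      apply hv0
      rw [← act_one v, ← inv_mul_cancel ⟨T, Complex.conjAe⟩, act_mul, h0]
      simp [act, Matrix.mulVec_zero, ← Pi.zero_def]
    have triv : ∀ u, MapsLine ⟨1, 1⟩ u u := MapsLine.one
    rw [hR1, hS1] at h
    refine h.not_isIrreducible hv0 hT (triv _) (triv _) (triv _) (triv _) ⟨1, by simp⟩ ?_ hirr
    exact ⟨c, by rw [← act_mul, hm]; exact hv1⟩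
  · have hN : S.1 - 1 ≠ 0 := fun h0 => hS1 (Subtype.ext (sub_eq_zero.mp h0))
    obtain ⟨v, hv, hRv, hSv⟩ := exists_common_kernel (M := R.1 - 1) hN (by simp [hx])
      (det_sub S hx) (by simp [tR]) (det_sub R tR) (by
        rw [sub_mul, mul_sub, one_mul, mul_one, Matrix.trace_sub, Matrix.trace_sub,
          Matrix.trace_sub, tRS, tR, hx]; simp)
    have hSz : ∀ z, S.1 *ᵥ z = z → ∃ c : ℂ, z = c • v := fun z hz =>
      exists_eq_smul_of_mulVec_eq_zero hN hv hSv (by rw [Matrix.sub_mulVec, hz]; simp)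
    rw [Matrix.sub_mulVec, Matrix.one_mulVec, sub_eq_zero] at hRv hSv
    have hR1 : MapsLine ⟨R, 1⟩ v v := mapsLine_mk_one (c := 1) (by rw [hRv, one_smul])
    have hS1 : MapsLine ⟨S, 1⟩ v v := mapsLine_mk_one (c := 1) (by rw [hSv, one_smul])
    have hT : MapsLine ⟨T, Complex.conjAe⟩ v v := by
      apply hSz
      have e : act (⟨S, 1⟩ * ⟨T, Complex.conjAe⟩) v = act (⟨T, Complex.conjAe⟩ * ⟨R, 1⟩) v := by
        congr 1
        ext1
        · exact h.rel_r.symm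
        · exact one_mul _
      have e' : act ⟨R, 1⟩ v = v := hRv
      rw [act_mul, act_mul, e'] at e
      exact e
    exact h.not_isIrreducible hv hv hR1 hR1 hS1 hS1 hT hT hirr

/-! ### Irreducible pairs of matrices -/

/-- A common eigenvector forces `tr [R, S] = 2`. On the circle, with `tr R = tr (R S) = x̄` and
`tr S = x`, this reads `(2 Re x + 1) (Re x - 2) = 0`. -/
lemma no_common_eigenvector {R S : SL2} {x : ℂ} (hS : S.1.trace = x)
    (hR : R.1.trace = starRingEnd ℂ x) (hRS : (R * S).1.trace = starRingEnd ℂ x)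
    (hx : x * starRingEnd ℂ x = x + starRingEnd ℂ x) (hx2 : x ≠ 2) {v : Fin 2 → ℂ} (hv : v ≠ 0)
    {a b : ℂ} (ha : R.1 *ᵥ v = a • v) (hb : S.1 *ᵥ v = b • v) : False := by
  have quad : ∀ (A : SL2) (c : ℂ), A.1 *ᵥ v = c • v → c * c + 1 = A.1.trace * c := by
    intro A c h
    have h0 : (A.1 - c • (1 : Matrix (Fin 2) (Fin 2) ℂ)).det = 0 :=
      Matrix.exists_mulVec_eq_zero_iff.mp ⟨v, hv, by
        rw [Matrix.sub_mulVec, h, Matrix.smul_mulVec, Matrix.one_mulVec, sub_self]⟩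
    have hd := A.det_coe
    rw [Matrix.det_fin_two] at h0 hd
    rw [Matrix.trace_fin_two]
    simp only [Matrix.sub_apply, Matrix.smul_apply, Matrix.one_apply_eq, ne_eq, zero_ne_one,
      one_ne_zero, not_false_eq_true, Matrix.one_apply_ne, smul_eq_mul] at h0
    linear_combination h0 - hd
  have h1 := quad R a ha
  have h2 := quad S b hb
  have h3 := quad (R * S) (a * b) (by
    rw [Matrix.SpecialLinearGroup.coe_mul, ← Matrix.mulVec_mulVec, hb, Matrix.mulVec_smul, ha,
      smul_smul, mul_comm])
  rw [hR] at h1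
  rw [hS] at h2
  rw [hRS] at h3
  have a0 : a ≠ 0 := by rintro rfl; simp at h1
  have b0 : b ≠ 0 := by rintro rfl; simp at h2
  set y := starRingEnd ℂ x with hy
  have e1 : y = a + a⁻¹ := by field_simp; linear_combination -h1
  have e2 : x = b + b⁻¹ := by field_simp; linear_combination -h2
  have e3 : y = a * b + a⁻¹ * b⁻¹ := by field_simp; linear_combination -h3
  have comm : y * y + x * x + y * y - y * x * y = 4 := by
    have : (a + a⁻¹) * (a + a⁻¹) + (b + b⁻¹) * (b + b⁻¹) +
        (a * b + a⁻¹ * b⁻¹) * (a * b + a⁻¹ * b⁻¹) -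
        (a + a⁻¹) * (b + b⁻¹) * (a * b + a⁻¹ * b⁻¹) = 4 := by
      field_simp; ring
    rwa [← e1, ← e2, ← e3] at this
  have r1 := congrArg Complex.re hx
  have r2 := congrArg Complex.re comm
  simp [hy] at r1 r2
  have hprod : (2 * x.re + 1) * (x.re - 2) = 0 := by
    linear_combination (1 / 2) * r2 + ((1 / 2) * x.re + 3 / 2) * r1
  have hre : x.re = 2 := by
    rcases mul_eq_zero.mp hprod with h | h
    · nlinarith [mul_self_nonneg x.re, mul_self_nonneg x.im]
    · linarith
  have him : x.im = 0 := by
    rw [hre] at r1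
    exact mul_self_eq_zero.mp (by linarith)
  exact hx2 (Complex.ext (by simp [hre]) (by simp [him]))

/-- Normal form of the value at `r`; here `tr S = q² + 2` and `p` is the conjugate of `q`. -/
def normalR (p : ℂ) : SL2 := ⟨!![p * p + 2, -1; 1, 0], by simp [Matrix.det_fin_two]⟩

/-- Normal form of the value at `s`. -/
def normalS (q : ℂ) : SL2 := ⟨!![1, q; q, q * q + 1], by simp [Matrix.det_fin_two]⟩

/-- A pair of matrices without common eigenvector and with traces `p² + 2`, `q² + 2`, and
`p² + 2` for the product, is conjugate to the normal form: the new basis is `v`, `-R⁻¹ v` with `v`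
in the kernel of `S - 1 + q R⁻¹`. -/
lemma exists_conj_normal {R S : SL2} {p q : ℂ} (hq : q ≠ 0) (hR : R.1.trace = p * p + 2)
    (hS : S.1.trace = q * q + 2) (hRS : (R * S).1.trace = p * p + 2)
    (hirr : ∀ v : Fin 2 → ℂ, v ≠ 0 → ∀ a b : ℂ, R.1 *ᵥ v = a • v → S.1 *ᵥ v = b • v → False) :
    ∃ g : SL2, R * g = g * normalR p ∧ S * g = g * normalS q := by
  have dR := R.det_coe
  have dS := S.det_coe
  simp only [Matrix.SpecialLinearGroup.coe_mul, Matrix.trace_fin_two, Matrix.det_fin_two,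
    Matrix.mul_apply, Fin.sum_univ_two] at dR dS hR hS hRS
  obtain ⟨v, hv, hker⟩ : ∃ v, v ≠ 0 ∧ (S.1 - 1 + q • (R⁻¹).1) *ᵥ v = 0 := by
    have i00 : (R⁻¹).1 0 0 = R.1 1 1 := by rw [Matrix.SpecialLinearGroup.SL2_inv_expl]; rfl
    have i01 : (R⁻¹).1 0 1 = -R.1 0 1 := by rw [Matrix.SpecialLinearGroup.SL2_inv_expl]; rfl
    have i10 : (R⁻¹).1 1 0 = -R.1 1 0 := by rw [Matrix.SpecialLinearGroup.SL2_inv_expl]; rfl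
    have i11 : (R⁻¹).1 1 1 = R.1 0 0 := by rw [Matrix.SpecialLinearGroup.SL2_inv_expl]; rfl
    rw [Matrix.exists_mulVec_eq_zero_iff, Matrix.det_fin_two]
    simp only [Matrix.add_apply, Matrix.sub_apply, Matrix.smul_apply, Matrix.one_apply_eq, ne_eq,
      zero_ne_one, one_ne_zero, not_false_eq_true, Matrix.one_apply_ne, smul_eq_mul, i00, i01, i10,
      i11]
    linear_combination dS - hS + q * q * dR + q * (hRS - hR)
  set w := -((R⁻¹).1 *ᵥ v) with hw
  have hRw : R.1 *ᵥ w = -v := by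
    rw [hw, Matrix.mulVec_neg, Matrix.mulVec_mulVec, ← Matrix.SpecialLinearGroup.coe_mul]
    simp
  have hSv : S.1 *ᵥ v = v + q • w := by
    rw [Matrix.add_mulVec, Matrix.sub_mulVec, Matrix.smul_mulVec, Matrix.one_mulVec] at hker
    rw [hw, smul_neg, ← sub_eq_add_neg, eq_sub_iff_add_eq, ← sub_eq_zero, ← hker]
    abel
  have hdet : v 0 * w 1 - v 1 * w 0 ≠ 0 := by
    intro h
    obtain ⟨c, hc⟩ := exists_eq_smul_of_det_eq_zero hv (sub_eq_zero.mp h)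
    have hc0 : c ≠ 0 := by
      rintro rfl
      rw [hc, zero_smul, Matrix.mulVec_zero] at hRw
      exact hv (neg_eq_zero.mp hRw.symm)
    refine hirr v hv (-c⁻¹) (1 + q * c) ?_ ?_
    · rw [hc, Matrix.mulVec_smul] at hRw
      rw [neg_smul, ← smul_neg, ← hRw, smul_smul, inv_mul_cancel₀ hc0, one_smul]
    · rw [hSv, hc, add_smul, one_smul, smul_smul]
  obtain ⟨d, hd⟩ := IsAlgClosed.exists_eq_mul_self (v 0 * w 1 - v 1 * w 0)
  have hd0 : d ≠ 0 := by rintro rfl; exact hdet (by simpa using hd)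
  have r0 := congrFun hRw 0
  have r1 := congrFun hRw 1
  have s0 := congrFun hSv 0
  have s1 := congrFun hSv 1
  simp only [Matrix.mulVec, dotProduct, Fin.sum_univ_two, Pi.neg_apply, Pi.add_apply,
    Pi.smul_apply, smul_eq_mul] at r0 r1 s0 s1
  -- The Cayley-Hamilton theorem gives the remaining columns, `R v = (tr R) v + w` and, after
  -- division by `q`, `S w = q v + (tr S - 1) w`.
  have g00 : R.1 0 0 * v 0 + R.1 0 1 * v 1 = (p * p + 2) * v 0 + w 0 := by
    linear_combination v 0 * hR - R.1 1 1 * r0 + R.1 0 1 * r1 + w 0 * dR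
  have g10 : R.1 1 0 * v 0 + R.1 1 1 * v 1 = (p * p + 2) * v 1 + w 1 := by
    linear_combination v 1 * hR + R.1 1 0 * r0 - R.1 0 0 * r1 + w 1 * dR
  have h01 : S.1 0 0 * w 0 + S.1 0 1 * w 1 = q * v 0 + (q * q + 1) * w 0 := by
    refine mul_left_cancel₀ hq ?_
    linear_combination (S.1 1 1 - 1) * s0 - S.1 0 1 * s1 + (v 0 + q * w 0) * hS - v 0 * dS
  have h11 : S.1 1 0 * w 0 + S.1 1 1 * w 1 = q * v 1 + (q * q + 1) * w 1 := by
    refine mul_left_cancel₀ hq ?_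
    linear_combination (S.1 0 0 - 1) * s1 - S.1 1 0 * s0 + (v 1 + q * w 1) * hS - v 1 * dS
  refine ⟨⟨d⁻¹ • !![v 0, w 0; v 1, w 1], ?_⟩, ?_, ?_⟩
  · rw [Matrix.det_smul, Matrix.det_fin_two_of, Fintype.card_fin]
    field_simp
    linear_combination hd
  · refine Subtype.ext ?_
    change R.1 * (d⁻¹ • !![v 0, w 0; v 1, w 1]) = (d⁻¹ • !![v 0, w 0; v 1, w 1]) * (normalR p).1
    rw [Matrix.mul_smul, Matrix.smul_mul]
    congr 1
    ext i j
    fin_cases i <;> fin_cases j <;> simp [normalR, Matrix.mul_apply, Fin.sum_univ_two]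
    · linear_combination g00
    · linear_combination r0
    · linear_combination g10
    · linear_combination r1
  · refine Subtype.ext ?_
    change S.1 * (d⁻¹ • !![v 0, w 0; v 1, w 1]) = (d⁻¹ • !![v 0, w 0; v 1, w 1]) * (normalS q).1
    rw [Matrix.mul_smul, Matrix.smul_mul]
    congr 1
    ext i j
    fin_cases i <;> fin_cases j <;> simp [normalS, Matrix.mul_apply, Fin.sum_univ_two]
    · linear_combination s0
    · linear_combination h01
    · linear_combination s1
    · linear_combination h11

/-- Schur's lemma for the normal form. -/
lemma eq_one_or_neg_one_of_commute_normal {p q : ℂ} (hq : q ≠ 0) {C : SL2}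
    (hR : C * normalR p = normalR p * C) (hS : C * normalS q = normalS q * C) :
    C = 1 ∨ C = -1 := by
  have r := congrArg Subtype.val hR
  have t := congrArg Subtype.val hS
  rw [Matrix.SpecialLinearGroup.coe_mul, Matrix.SpecialLinearGroup.coe_mul] at r t
  replace t := congrFun₂ t 0 0
  have r00 := congrFun₂ r 0 0
  have r01 := congrFun₂ r 0 1
  have dC := C.det_coe
  rw [Matrix.det_fin_two] at dC
  simp [normalR, normalS, Matrix.mul_apply, Fin.sum_univ_two] at r00 r01 t
  have hbc : C 0 1 = C 1 0 := by
    rw [mul_comm] at t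
    exact mul_left_cancel₀ hq t
  have hc : C 1 0 = 0 := by
    have : 2 * C 1 0 = 0 := by linear_combination r00 - hbc
    simpa using this
  have had : C 1 1 = C 0 0 := by
    rw [hbc, hc] at r01
    linear_combination r01
  rw [hbc, hc, had] at dC
  rw [mul_zero, sub_zero, mul_self_eq_one_iff] at dC
  rcases dC with h | h
  · left; ext i j; fin_cases i <;> fin_cases j <;> simp [h, hbc, hc, had]
  · right; ext i j; fin_cases i <;> fin_cases j <;> simp [h, hbc, hc, had]

/-- A representation with `R`, `S` in normal form is determined by them. -/
lemma IsTriple.normal_unique {p q : ℂ} (hq : q ≠ 0) {T T' : SL2}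
    (h : IsTriple (normalR p) (normalS q) T) (h' : IsTriple (normalR p) (normalS q) T') :
    (T : PSL2) = T' := by
  have comm : ∀ A B : SL2, T * bar A = B * T → T' * bar A = B * T' →
      bar (T⁻¹ * T') * A = A * bar (T⁻¹ * T') := by
    intro A B hA hB
    apply bar.injective
    rw [map_mul, map_mul bar A, bar_bar, mul_assoc, hB,
      eq_mul_inv_of_mul_eq hA.symm]
    group
  have h1 := comm _ _ h.rel_r h'.rel_r
  have h2 := comm _ _ h.rel_s h'.rel_s
  rcases eq_one_or_neg_one_of_commute_normal hq h1 h2 with e | e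
  · rw [MulEquiv.map_eq_one_iff, inv_mul_eq_one] at e
    rw [e]
  · have e' := congrArg bar e
    rw [bar_bar, bar_neg, map_one, inv_mul_eq_iff_eq_mul, mul_neg, mul_one] at e'
    rw [e', psl_neg]

/-! ### The intertwiner -/

/-- The matrix, up to a scalar, of the value at `t` when `R`, `S` are in normal form. -/
def tMat (p q : ℂ) : Matrix (Fin 2) (Fin 2) ℂ :=
  !![1 - q - p, q * (q * q - q + 1) + q + p - 1; 1 - q * p, -(q * q - q + 1)]

lemma tMat_mul_r (p q : ℂ) :
    tMat p q * (normalR q).1 = (normalS q).1 * tMat p q := by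
  ext i j
  fin_cases i <;> fin_cases j <;> simp [normalR, normalS, tMat, Matrix.mul_apply, Fin.sum_univ_two]
  all_goals grind

lemma tMat_mul_s {p q : ℂ} (h : p * p * (q * q) + p * p + q * q = 0) :
    tMat p q * (normalS p).1 = (normalR p).1 * (normalS q).1 * tMat p q := by
  ext i j
  fin_cases i <;> fin_cases j <;> simp [normalR, normalS, tMat, Matrix.mul_apply, Fin.sum_univ_two]
  all_goals grind

lemma tMat_det {p q : ℂ} (h : p * p * (q * q) + p * p + q * q = 0) :
    (tMat p q).det = (q + p - 1) * (q * (q + p) * (1 + q * p) + (1 - q * p) * (q * p)) := by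
  simp [tMat, Matrix.det_fin_two]
  grind

/-! ### The parameter -/

/-- A continuous branch of `√(x - 2)` along the upper half `x = 2u + 2i √(u - u²)` of the circle
`|x - 1| = 1`. The other branch makes `tMat` vanish at `u = 3/4`. -/
def param (u : ℝ) : ℂ :=
  ⟨-√(√(1 - u) - √(1 - u) * √(1 - u)), -√(√(1 - u) + √(1 - u) * √(1 - u))⟩

lemma continuous_param : Continuous param := by
  have : param = fun u => Complex.equivRealProdCLM.symm
      (-√(√(1 - u) - √(1 - u) * √(1 - u)), -√(√(1 - u) + √(1 - u) * √(1 - u))) := rfl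
  rw [this]
  fun_prop

/-- The equations satisfied by the parameter, in terms of `w = √(1 - u)`. -/
lemma param_spec {u : ℝ} (hu : u ∈ Set.Ico (0 : ℝ) 1) :
    ∃ w : ℝ, 0 < w ∧ w ≤ 1 ∧ w * w = 1 - u ∧ (param u).re ≤ 0 ∧ (param u).im < 0 ∧
      (param u).re * (param u).re = w - w * w ∧ (param u).im * (param u).im = w + w * w := by
  have h1 : 0 < 1 - u := by linarith [hu.2]
  have hw : √(1 - u) ≤ 1 := Real.sqrt_le_one.mpr (by linarith [hu.1])
  have hw0 : 0 < √(1 - u) := Real.sqrt_pos.mpr h1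
  refine ⟨√(1 - u), hw0, hw, Real.mul_self_sqrt h1.le, ?_, ?_, ?_, ?_⟩
  · simp [param]
  · simp only [param, Left.neg_neg_iff]
    positivity
  · simp only [param, neg_mul_neg]
    exact Real.mul_self_sqrt (by nlinarith)
  · simp only [param, neg_mul_neg]
    exact Real.mul_self_sqrt (by positivity)

lemma param_ne_zero {u : ℝ} (hu : u ∈ Set.Ico (0 : ℝ) 1) : param u ≠ 0 := by
  obtain ⟨w, -, -, -, -, h, -⟩ := param_spec hu
  exact fun h0 => h.ne (by rw [h0]; rfl)

lemma param_rel {u : ℝ} (hu : u ∈ Set.Ico (0 : ℝ) 1) :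
    starRingEnd ℂ (param u) * starRingEnd ℂ (param u) * (param u * param u) +
      starRingEnd ℂ (param u) * starRingEnd ℂ (param u) + param u * param u = 0 := by
  obtain ⟨w, -, -, -, -, -, ha, hb⟩ := param_spec hu
  set a := (param u).re
  set b := (param u).im
  apply Complex.ext <;> simp
  · linear_combination (a * a + b * b + 2 + 2 * w) * ha + (a * a + b * b - 2 + 2 * w) * hb
  · ring

/-- The trace of `ρ(s)` as a function of the parameter. -/
def paramTrace (u : ℝ) : ℂ := param u * param u + 2

lemma continuous_paramTrace : Continuous paramTrace :=
  (continuous_param.mul continuous_param).add continuous_const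

lemma paramTrace_re {u : ℝ} (hu : u ∈ Set.Ico (0 : ℝ) 1) : (paramTrace u).re = 2 * u := by
  obtain ⟨w, -, -, hw, -, -, ha, hb⟩ := param_spec hu
  simp [paramTrace]
  linear_combination ha - hb - 2 * hw

lemma paramTrace_mul_conj {u : ℝ} (hu : u ∈ Set.Ico (0 : ℝ) 1) :
    paramTrace u * starRingEnd ℂ (paramTrace u) =
      paramTrace u + starRingEnd ℂ (paramTrace u) := by
  simp only [paramTrace, map_add, map_mul, map_ofNat]
  linear_combination param_rel hu

lemma paramTrace_ne_two {u : ℝ} (hu : u ∈ Set.Ico (0 : ℝ) 1) : paramTrace u ≠ 2 := by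
  simp [paramTrace, param_ne_zero hu]

lemma tMat_det_mem_slitPlane {u : ℝ} (hu : u ∈ Set.Ico (0 : ℝ) 1) :
    (tMat (starRingEnd ℂ (param u)) (param u)).det ∈ Complex.slitPlane := by
  obtain ⟨w, hw0, hw1, hw, ha0, hb0, ha, hb⟩ := param_spec hu
  rw [tMat_det (param_rel hu)]
  set q := param u
  -- With `a = Re q` and `b = Im q` the determinant has imaginary part
  -- `2 a b (2 a - 1) (1 + 2 w)`, which is negative unless `a = 0`, and then `w = 1`.
  have hs : q + starRingEnd ℂ q = (2 * q.re : ℝ) := Complex.add_conj q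
  have hp : q * starRingEnd ℂ q = (2 * w : ℝ) := by
    rw [Complex.mul_conj, Complex.normSq_apply, ha, hb]; congr 1; ring
  rw [hp, hs, Complex.mem_slitPlane_iff]
  rcases ha0.lt_or_eq with h | h
  · right
    have him : ((((2 * q.re : ℝ) : ℂ) - 1) * (q * ((2 * q.re : ℝ) : ℂ) * (1 + ((2 * w : ℝ) : ℂ)) +
        (1 - ((2 * w : ℝ) : ℂ)) * ((2 * w : ℝ) : ℂ))).im =
        (2 * q.re - 1) * (q.im * (2 * q.re) * (1 + 2 * w)) := by
      simp
    rw [him]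
    have h1 : 2 * q.re - 1 < 0 := by linarith
    have h2 : 0 < q.im * (2 * q.re) := mul_pos_of_neg_of_neg hb0 (by linarith)
    exact (mul_neg_of_neg_of_pos h1 (by positivity)).ne
  · left
    have hw' : w = 1 := by
      rw [h] at ha
      have : w * (1 - w) = 0 := by linarith
      rcases mul_eq_zero.mp this with h | h <;> linarith
    rw [h, hw']
    norm_num

/-! ### The normal form of a representation -/

/-- The value at `t` of the normal form. -/
def normalT (u : Set.Ico (0 : ℝ) 1) : SL2 :=
  ⟨((tMat (starRingEnd ℂ (param u)) (param u)).det ^ ((2 : ℕ) : ℂ)⁻¹)⁻¹ •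
      tMat (starRingEnd ℂ (param u)) (param u), by
    have h0 := Complex.slitPlane_ne_zero (tMat_det_mem_slitPlane u.2)
    have h := Complex.cpow_nat_inv_pow (tMat (starRingEnd ℂ (param u)) (param u)).det two_ne_zero
    rw [Matrix.det_smul, Fintype.card_fin, inv_pow, h, inv_mul_cancel₀ h0]⟩

lemma bar_normalR (p : ℂ) : bar (normalR p) = normalR (starRingEnd ℂ p) := by
  ext i j
  rw [bar_apply]
  fin_cases i <;> fin_cases j <;> simp [normalR, Complex.conj_ofNat]

lemma bar_normalS (q : ℂ) : bar (normalS q) = normalS (starRingEnd ℂ q) := by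
  ext i j
  rw [bar_apply]
  fin_cases i <;> fin_cases j <;> simp [normalS]

lemma isTriple_normal (u : Set.Ico (0 : ℝ) 1) :
    IsTriple (normalR (starRingEnd ℂ (param u))) (normalS (param u)) (normalT u) where
  rel_r := by
    rw [bar_normalR, Complex.conj_conj]
    refine Subtype.ext ?_
    rw [Matrix.SpecialLinearGroup.coe_mul, Matrix.SpecialLinearGroup.coe_mul, normalT,
      Matrix.smul_mul, Matrix.mul_smul, tMat_mul_r]
  rel_s := by
    rw [bar_normalS]
    refine Subtype.ext ?_
    rw [Matrix.SpecialLinearGroup.coe_mul, Matrix.SpecialLinearGroup.coe_mul,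
      Matrix.SpecialLinearGroup.coe_mul, normalT, Matrix.smul_mul, Matrix.mul_smul,
      tMat_mul_s (param_rel u.2)]

lemma trace_normalS (q : ℂ) : (normalS q).1.trace = q * q + 2 := by
  simp [normalS, Matrix.trace_fin_two]; ring

lemma IsTriple.no_common_eigenvector {R S T : SL2} (h : IsTriple R S T) (hS : S.1.trace ≠ 2)
    (v : Fin 2 → ℂ) (hv : v ≠ 0) (a b : ℂ) (ha : R.1 *ᵥ v = a • v) (hb : S.1 *ᵥ v = b • v) :
    False :=
  Gieseking.no_common_eigenvector rfl h.conj_trace.symm (h.trace_mul.trans h.conj_trace.symm)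
    h.trace_mul_conj hS hv ha hb

lemma IsTriple.isIrreducible_rep {R S T : SL2} (h : IsTriple R S T) (hS : S.1.trace ≠ 2) :
    IsIrreducible h.rep := by
  rintro ⟨L, hL, hinv⟩
  obtain ⟨⟨v, hvL⟩, hv, hspan⟩ := finrank_eq_one_iff'.mp hL
  have key : ∀ A : SL2, (∀ v ∈ L, A.1 *ᵥ v ∈ L) → ∃ c : ℂ, A.1 *ᵥ v = c • v := fun A hA => by
    obtain ⟨c, hc⟩ := hspan ⟨_, hA v hvL⟩
    exact ⟨c, (congrArg Subtype.val hc).symm⟩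
  obtain ⟨a, ha⟩ := key R (hinv _ R h.isTripleOf.map_r)
  obtain ⟨b, hb⟩ := key S (hinv _ S h.isTripleOf.map_s)
  exact h.no_common_eigenvector hS v (fun h0 => hv (Subtype.ext h0)) a b ha hb

lemma IsTriple.lift_right {R S T : SL2} (h : IsTriple R S T) (γ : Pi1) :
    (h.lift γ).right = 1 ∧ orientationChar γ = 1 ∨
      (h.lift γ).right = Complex.conjAe ∧ orientationChar γ = -1 := by
  refine pi1_induction (P := fun γ => (h.lift γ).right = 1 ∧ orientationChar γ = 1 ∨
      (h.lift γ).right = Complex.conjAe ∧ orientationChar γ = -1)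
    (Or.inl ?_) (Or.inl ?_) (Or.inl ?_) (Or.inr ?_) ?_ ?_ γ
  · simp
  · rw [IsTriple.lift, homOfRelations_r]; exact ⟨rfl, orientationChar_r⟩
  · rw [IsTriple.lift, homOfRelations_s]; exact ⟨rfl, orientationChar_s⟩
  · rw [IsTriple.lift, homOfRelations_t]; exact ⟨rfl, orientationChar_t⟩
  · rintro γ (⟨h1, h2⟩ | ⟨h1, h2⟩) <;>
      simp only [map_inv, SemidirectProduct.inv_right, h1, h2]
    · simp
    · right; exact ⟨conjAe_inv, by simp⟩
  · rintro γ δ (⟨h1, h2⟩ | ⟨h1, h2⟩) (⟨k1, k2⟩ | ⟨k1, k2⟩) <;>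
      simp only [map_mul, SemidirectProduct.mul_right, h1, h2, k1, k2]
    · simp
    · simp
    · simp
    · left; exact ⟨conjAe_mul_conjAe, by simp⟩

lemma IsTriple.lift_right_eq {R S T : SL2} (h : IsTriple R S T) (γ : Pi1) :
    (h.lift γ).right = if orientationChar γ = 1 then 1 else Complex.conjAe := by
  rcases h.lift_right γ with ⟨h1, h2⟩ | ⟨h1, h2⟩ <;> rw [h1, h2]
  · simp
  · rw [if_neg (by decide)]

lemma IsTriple.preservesOrientationType_rep {R S T : SL2} (h : IsTriple R S T) :
    PreservesOrientationType h.rep := by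
  intro γ
  change (h.lift γ).right = 1 ↔ _
  rcases h.lift_right γ with ⟨h1, h2⟩ | ⟨h1, h2⟩
  · simp [h1, h2]
  · rw [h1, h2]
    exact ⟨fun h => absurd h conjAe_ne_one, fun h => absurd h (by decide)⟩

/-- The family of representations in normal form. -/
def normalRep (u : Set.Ico (0 : ℝ) 1) : HomIrrPlus :=
  ⟨(isTriple_normal u).rep,
    (isTriple_normal u).isIrreducible_rep (by rw [trace_normalS]; exact paramTrace_ne_two u.2),
    (isTriple_normal u).preservesOrientationType_rep⟩

lemma continuous_conjSL (σ : ConjGroup) : Continuous (conjSL σ) := by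
  rcases conjGroup_cases σ with rfl | rfl
  · simpa using continuous_id
  · refine Continuous.subtype_mk (continuous_matrix fun i j => ?_) _
    exact Complex.continuous_conj.comp (continuous_subtype_val.matrix_elem i j)

lemma continuous_normalRep : Continuous normalRep := by
  have hp : Continuous fun u : Set.Ico (0 : ℝ) 1 => param u :=
    continuous_param.comp continuous_subtype_val
  have hp' : Continuous fun u : Set.Ico (0 : ℝ) 1 => starRingEnd ℂ (param u) :=
    Complex.continuous_conj.comp hp
  have hT : Continuous fun u : Set.Ico (0 : ℝ) 1 => tMat (starRingEnd ℂ (param u)) (param u) := by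
    refine continuous_matrix fun i j => ?_
    fin_cases i <;> fin_cases j <;> simp [tMat] <;> fun_prop
  have key : ∀ γ, Continuous fun u => ((isTriple_normal u).lift γ).left := by
    refine pi1_induction ?_ ?_ ?_ ?_ ?_ ?_
    · simp only [map_one]; exact continuous_const
    · simp only [IsTriple.lift, homOfRelations_r]
      refine Continuous.subtype_mk (continuous_matrix fun i j => ?_) _
      fin_cases i <;> fin_cases j <;> simp <;> fun_prop
    · simp only [IsTriple.lift, homOfRelations_s]
      refine Continuous.subtype_mk (continuous_matrix fun i j => ?_) _
      fin_cases i <;> fin_cases j <;> simp <;> fun_prop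
    · simp only [IsTriple.lift, homOfRelations_t]
      have hd := hT.matrix_det.cpow (continuous_const (y := ((2 : ℕ) : ℂ)⁻¹)) fun u =>
        tMat_det_mem_slitPlane u.2
      refine Continuous.subtype_mk ((hd.inv₀ fun u => ?_).smul hT) _
      have := Complex.slitPlane_ne_zero (tMat_det_mem_slitPlane u.2)
      simp [Complex.cpow_eq_zero_iff, this]
    · intro γ h
      have e : ∀ u, ((isTriple_normal u).lift γ⁻¹).left =
          conjSL (if orientationChar γ = 1 then 1 else Complex.conjAe)⁻¹
            ((isTriple_normal u).lift γ).left⁻¹ := fun u => by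
        rw [map_inv, SemidirectProduct.inv_left, IsTriple.lift_right_eq]
      simp only [e]
      exact (continuous_conjSL _).comp h.inv
    · intro γ δ h k
      simp only [map_mul, SemidirectProduct.mul_left, IsTriple.lift_right_eq]
      exact h.mul ((continuous_conjSL _).comp k)
  refine continuous_induced_rng.mpr (continuous_pi fun γ => continuous_induced_rng.mpr ?_)
  refine Continuous.prodMk (QuotientGroup.continuous_mk.comp (key γ)) ?_
  change Continuous fun u => ((isTriple_normal u).lift γ).right
  simp only [IsTriple.lift_right_eq]
  exact continuous_const

/-! ### Conjugation to the normal form -/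

lemma IsTripleOf.conj_normalRep {ρ : Pi1 →* IsomH3} {R S T : SL2} (h : IsTripleOf ρ R S T)
    (u : Set.Ico (0 : ℝ) 1) (hS : S.1.trace = paramTrace u) :
    ∃ k : IsomH3, ∀ γ, ρ γ = k * (normalRep u).1 γ * k⁻¹ := by
  have hR : R.1.trace = starRingEnd ℂ (param u) * starRingEnd ℂ (param u) + 2 := by
    rw [← h.conj_trace, hS, paramTrace, map_add, map_mul, map_ofNat]
  obtain ⟨g, hgR, hgS⟩ := exists_conj_normal (param_ne_zero u.2) hR hS (h.trace_mul.trans hR)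
    (h.no_common_eigenvector (by rw [hS]; exact paramTrace_ne_two u.2))
  have eR : R = g * normalR (starRingEnd ℂ (param u)) * g⁻¹ := eq_mul_inv_of_mul_eq hgR
  have eS : S = g * normalS (param u) * g⁻¹ := eq_mul_inv_of_mul_eq hgS
  have hg : IsTriple (normalR (starRingEnd ℂ (param u))) (normalS (param u))
      (g⁻¹ * T * bar g) := by
    have h1 := h.rel_r
    have h2 := h.rel_s
    rw [eR, map_mul, map_mul, map_inv, ← mul_assoc, mul_inv_eq_iff_eq_mul, eS] at h1
    rw [eR, eS, map_mul, map_mul, map_inv, ← mul_assoc, mul_inv_eq_iff_eq_mul] at h2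
    constructor
    · simp only [mul_assoc] at h1 ⊢
      rw [h1]; group
    · simp only [mul_assoc] at h2 ⊢
      rw [h2]; group
  have hT := hg.normal_unique (param_ne_zero u.2) (isTriple_normal u)
  have hn := (isTriple_normal u).isTripleOf
  refine ⟨⟨(g : PSL2), 1⟩, fun γ => ?_⟩
  have : ρ = (MulAut.conj (⟨(g : PSL2), 1⟩ : IsomH3)).toMonoidHom.comp (normalRep u).1 := by
    apply hom_eq_of_generators
    all_goals
      rw [MonoidHom.comp_apply, MulEquiv.coe_toMonoidHom, MulAut.conj_apply, eq_mul_inv_iff_mul_eq]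
    · rw [h.map_r, normalRep, hn.map_r]
      ext1
      · exact congrArg (QuotientGroup.mk (s := Subgroup.center _)) hgR
      · rfl
    · rw [h.map_s, normalRep, hn.map_s]
      ext1
      · exact congrArg (QuotientGroup.mk (s := Subgroup.center _)) hgS
      · rfl
    · rw [h.map_t, normalRep, hn.map_t, ← hT]
      ext1
      · refine congrArg (QuotientGroup.mk (s := Subgroup.center _))
          (?_ : T * bar g = g * (g⁻¹ * T * bar g))
        group
      · rfl
  exact DFunLike.congr_fun this γ

lemma IsTripleOf.bar {ρ : Pi1 →* IsomH3} {R S T : SL2} (h : IsTripleOf ρ R S T) :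
    IsTripleOf ((MulAut.conj (SemidirectProduct.inr Complex.conjAe : IsomH3)).toMonoidHom.comp ρ)
      (bar R) (bar S) (bar T) where
  rel_r := by rw [← map_mul, h.rel_r, map_mul]
  rel_s := by rw [← map_mul, h.rel_s, map_mul, map_mul]
  map_r := by
    rw [MonoidHom.comp_apply, MulEquiv.coe_toMonoidHom, MulAut.conj_apply, mul_inv_eq_iff_eq_mul,
      h.map_r]
    ext1 <;> simp
  map_s := by
    rw [MonoidHom.comp_apply, MulEquiv.coe_toMonoidHom, MulAut.conj_apply, mul_inv_eq_iff_eq_mul,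
      h.map_s]
    ext1 <;> simp
  map_t := by
    rw [MonoidHom.comp_apply, MulEquiv.coe_toMonoidHom, MulAut.conj_apply, mul_inv_eq_iff_eq_mul,
      h.map_t]
    ext1 <;> simp

/-! ### The punctured circle -/

lemma norm_sub_one_eq_one_iff {x : ℂ} :
    ‖x - 1‖ = 1 ↔ x * starRingEnd ℂ x = x + starRingEnd ℂ x := by
  rw [← sq_eq_sq₀ (norm_nonneg _) zero_le_one, ← Complex.normSq_eq_norm_sq, Complex.normSq_apply,
    Complex.ext_iff]
  simp
  constructor
  · intro h; exact ⟨by linarith, by ring⟩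
  · rintro ⟨h, -⟩; linarith

lemma normSq_div_four {x : ℂ} (hx : x * starRingEnd ℂ x = x + starRingEnd ℂ x) :
    Complex.normSq x / 4 = x.re / 2 := by
  have h := congrArg Complex.re hx
  rw [Complex.mul_conj, Complex.ofReal_re] at h
  rw [h]
  simp
  ring

lemma re_div_two_mem {x : ℂ} (hx : x * starRingEnd ℂ x = x + starRingEnd ℂ x) (h2 : x ≠ 2) :
    x.re / 2 ∈ Set.Ico (0 : ℝ) 1 := by
  have h := congrArg Complex.re hx
  simp at h
  refine ⟨by nlinarith [mul_self_nonneg x.re, mul_self_nonneg x.im], ?_⟩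
  by_contra! hle
  have hre : x.re = 2 := by nlinarith [mul_self_nonneg x.im]
  have him : x.im = 0 := mul_self_eq_zero.mp (by rw [hre] at h; linarith)
  exact h2 (Complex.ext (by simp [hre]) (by simp [him]))

lemma eq_or_eq_conj {x y : ℂ} (hx : x * starRingEnd ℂ x = x + starRingEnd ℂ x)
    (hy : y * starRingEnd ℂ y = y + starRingEnd ℂ y) (h : x.re = y.re) :
    y = x ∨ y = starRingEnd ℂ x := by
  have h1 := congrArg Complex.re hx
  have h2 := congrArg Complex.re hy
  simp at h1 h2
  rcases mul_self_eq_mul_self_iff.mp (show y.im * y.im = x.im * x.im by rw [← h] at h2; linarith)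
    with h' | h'
  · exact Or.inl (Complex.ext h.symm h')
  · exact Or.inr (Complex.ext h.symm h')

/-- Half the real part identifies the punctured circle modulo conjugation with `[0, 1)`. -/
def circleHomeo : PuncturedCircleModConj ≃ₜ Set.Ico (0 : ℝ) 1 where
  toFun := Quotient.lift
    (fun x : PuncturedCircle =>
      ⟨(x : ℂ).re / 2, re_div_two_mem (norm_sub_one_eq_one_iff.mp x.2.1) x.2.2⟩)
    (by
      rintro x y (h | h) <;> simp [h])
  invFun u := Quotient.mk circleSetoid
    ⟨paramTrace u, norm_sub_one_eq_one_iff.mpr (paramTrace_mul_conj u.2), paramTrace_ne_two u.2⟩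
  left_inv := by
    intro z
    induction z using Quotient.inductionOn with
    | _ x =>
      have hx := norm_sub_one_eq_one_iff.mp x.2.1
      have hu := re_div_two_mem hx x.2.2
      exact Quotient.sound
        (eq_or_eq_conj (paramTrace_mul_conj hu) hx ((paramTrace_re hu).trans (by ring)))
  right_inv u := by
    ext
    simp [paramTrace_re u.2]
  continuous_toFun := by
    refine Continuous.quotient_lift (Continuous.subtype_mk ?_ _) _
    exact (Complex.continuous_re.comp continuous_subtype_val).div_const 2
  continuous_invFun := continuous_quotient_mk'.comp
    (Continuous.subtype_mk (continuous_paramTrace.comp continuous_subtype_val) _)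

/-! ### The invariant `|tr ρ(s)|² / 4` -/

/-- The function `|tr A|² / 4` on `PSL(2, ℂ)`. -/
def traceNormSq : PSL2 → ℝ :=
  Quotient.lift (s := QuotientGroup.leftRel _) (fun A : SL2 => Complex.normSq A.1.trace / 4) (by
    intro A B h
    rcases psl_eq_iff.mp (Quotient.sound h) with rfl | rfl
    · rfl
    · simp [Matrix.SpecialLinearGroup.coe_neg])

@[simp] lemma traceNormSq_coe (A : SL2) :
    traceNormSq (A : PSL2) = Complex.normSq A.1.trace / 4 := rfl

lemma continuous_traceNormSq : Continuous traceNormSq :=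
  Continuous.quotient_lift ((Complex.continuous_normSq.comp
    continuous_subtype_val.matrix_trace).div_const 4) _

lemma traceNormSq_conj {g h : IsomH3} (hh : h.right = 1) :
    traceNormSq (g * h * g⁻¹).left = traceNormSq h.left := by
  obtain ⟨A, hA⟩ := exists_coe_mk_eq (rfl : g.right = g.right)
  obtain ⟨S, rfl⟩ := exists_coe_mk_eq hh
  generalize g.right = σ at hA
  subst hA
  have e : ((⟨(A : PSL2), σ⟩ * ⟨(S : PSL2), 1⟩ * (⟨(A : PSL2), σ⟩ : IsomH3)⁻¹ : IsomH3)).left =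
      ((A * conjSL σ S * A⁻¹ : SL2) : PSL2) := by
    simp [SemidirectProduct.mul_left, SemidirectProduct.inv_left]
  rw [e, traceNormSq_coe, traceNormSq_coe, Matrix.SpecialLinearGroup.coe_mul,
    Matrix.trace_mul_comm, ← Matrix.SpecialLinearGroup.coe_mul, inv_mul_cancel_left]
  rcases conjGroup_cases σ with rfl | rfl
  · simp
  · rw [conjSL_conjAe, trace_bar, Complex.normSq_conj]

/-- The parameter in `[0, 1)` of an irreducible representation. -/
def invariant (ρ : HomIrrPlus) : ℝ := traceNormSq (ρ.1 s).left

lemma continuous_invariant : Continuous invariant := by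
  have h1 : Continuous fun ρ : HomIrrPlus => ρ.1 s :=
    (continuous_apply s).comp continuous_induced_dom
  have h2 : Continuous fun g : IsomH3 => (g.left, g.right) := continuous_induced_dom
  exact continuous_traceNormSq.comp (continuous_fst.comp (h2.comp h1))

lemma invariant_eq {ρ : HomIrrPlus} {R S T : SL2} (h : IsTripleOf ρ.1 R S T) :
    invariant ρ = S.1.trace.re / 2 := by
  rw [invariant, h.map_s, traceNormSq_coe, normSq_div_four h.trace_mul_conj]

lemma invariant_mem (ρ : HomIrrPlus) : invariant ρ ∈ Set.Ico (0 : ℝ) 1 := by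
  obtain ⟨R, S, T, h⟩ := ρ.2.2.exists_isTripleOf
  rw [invariant_eq h]
  exact re_div_two_mem h.trace_mul_conj (h.trace_ne_two ρ.2.1)

lemma invariant_normalRep (u : Set.Ico (0 : ℝ) 1) : invariant (normalRep u) = u := by
  rw [invariant_eq (ρ := normalRep u) (isTriple_normal u).isTripleOf, trace_normalS]
  change (paramTrace u).re / 2 = u
  rw [paramTrace_re u.2]; ring

/-- Every irreducible representation is conjugate to one in normal form. Complex conjugation, an
element of `Isom(ℍ³)`, moves the trace to the upper half of the circle if necessary. -/
lemma normalRep_equiv (ρ : HomIrrPlus) :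
    conjSetoid (normalRep ⟨invariant ρ, invariant_mem ρ⟩) ρ := by
  obtain ⟨R, S, T, h⟩ := ρ.2.2.exists_isTripleOf
  set u : Set.Ico (0 : ℝ) 1 := ⟨invariant ρ, invariant_mem ρ⟩
  have hu : S.1.trace.re = (paramTrace u).re := by
    rw [paramTrace_re u.2]
    change _ = 2 * invariant ρ
    rw [invariant_eq h]; ring
  rcases eq_or_eq_conj h.trace_mul_conj (paramTrace_mul_conj u.2) hu with e | e
  · exact h.conj_normalRep u e.symm
  · obtain ⟨k, hk⟩ := h.bar.conj_normalRep u (by rw [trace_bar, e])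
    refine ⟨(SemidirectProduct.inr Complex.conjAe)⁻¹ * k, fun γ => ?_⟩
    have := hk γ
    rw [MonoidHom.comp_apply, MulEquiv.coe_toMonoidHom, MulAut.conj_apply] at this
    rw [_root_.mul_inv_rev, inv_inv, mul_assoc, mul_assoc, ← mul_assoc k, ← mul_assoc _ k⁻¹, ← this]
    group

/-- The invariant identifies the space of conjugacy classes with `[0, 1)`; the normal form is a
continuous section. -/
def classesHomeo : ConjClassesIrrPlus ≃ₜ Set.Ico (0 : ℝ) 1 where
  toFun := Quotient.lift (fun ρ => ⟨invariant ρ, invariant_mem ρ⟩) (by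
    rintro ρ ρ' ⟨g, hg⟩
    ext
    change invariant ρ = invariant ρ'
    rw [invariant, invariant, hg, traceNormSq_conj ρ.2.2.right_s])
  invFun u := Quotient.mk conjSetoid (normalRep u)
  left_inv := by
    intro z
    induction z using Quotient.inductionOn with
    | _ ρ => exact Quotient.sound (normalRep_equiv ρ)
  right_inv u := Subtype.ext (invariant_normalRep u)
  continuous_toFun := Continuous.quotient_lift (continuous_invariant.subtype_mk _) _
  continuous_invFun := continuous_quotient_mk'.comp continuous_normalRep

end Gieseking

end

theorem mainTheorem8 :
    -- The trace of `ρ(s)` is a well-defined complex number.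
    (∀ ρ : Gieseking.HomIrrPlus, ∃! x : ℂ, Gieseking.IsTraceS ρ.1 x) ∧
    -- It induces a homeomorphism onto the punctured circle modulo complex conjugation.
    (∃ Φ : Gieseking.ConjClassesIrrPlus ≃ₜ Gieseking.PuncturedCircleModConj,
      ∀ (ρ : Gieseking.HomIrrPlus) (x : ℂ), Gieseking.IsTraceS ρ.1 x →
        ∃ hx : ‖x - 1‖ = 1 ∧ x ≠ 2,
          Φ (Quotient.mk Gieseking.conjSetoid ρ) =
            Quotient.mk Gieseking.circleSetoid ⟨x, hx⟩) ∧
    -- The space of conjugacy classes is homeomorphic to a half-open interval.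
    Nonempty (Gieseking.ConjClassesIrrPlus ≃ₜ Set.Ico (0 : ℝ) 1) := by
  refine ⟨fun ρ => ρ.2.2.existsUnique_isTraceS,
    ⟨Gieseking.classesHomeo.trans Gieseking.circleHomeo.symm, ?_⟩, ⟨Gieseking.classesHomeo⟩⟩
  intro ρ x hx
  obtain ⟨R, S, T, h⟩ := ρ.2.2.exists_isTripleOf
  obtain rfl := ρ.2.2.existsUnique_isTraceS.unique h.isTraceS hx
  refine ⟨⟨Gieseking.norm_sub_one_eq_one_iff.mpr h.trace_mul_conj, h.trace_ne_two ρ.2.1⟩, ?_⟩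
  rw [Homeomorph.trans_apply, Homeomorph.symm_apply_eq]
  exact Subtype.ext (Gieseking.invariant_eq h)
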